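/- Let $\Bbbk$ be a field, $R=\Bbbk[x_1,\ldots,x_n]$, let $L\subseteq\mathbb{Z}^n$ be a lattice (a subgroup), and let $I_L=\langle x^u-x^v : u,v\in\mathbb{N}^n,\ u-v\in L\rangle\subseteq R$ be its lattice ideal. An $I_L$-fiber is a set of monomials of the form $F_u=\{x^v : v\in\mathbb{N}^n,\ v-u\in L\}$ with $u\in\mathbb{N}^n$; for a binomial $B=x^u-x^v\in I_L$ with $u\ne v$ put $F_B=F_u$ (which equals $F_v$). Two $I_L$-fibers $F,G$ are equivalent if there are $u,v\in\mathbb{N}^n$ with $x^uF\subseteq G$ and $x^vG\subseteq F$; $\overline F$ denotes the equivalence class of $F$, and $F_{\{1\}}$ is the fiber containing the monomial $1$. A minimal generating set of $I_L$ is a finite set $S=\{B_1,\ldots,B_t\}$ of binomials $x^u-x^v$ that generates $I_L$ and no proper subset of which generates $I_L$. Then the multiset \[ \{\overline F_{B_i} : F_{B_i}\notin\overline F_{\{1\}}\} \] is an invariant of $I_L$: if $S$ and $S'$ are minimal generating sets of $I_L$, then the multisets formed from $S$ and from $S'$ coincide. Consequently \[ |S|-|S'| = |\{B\in S: F_B\in\overline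 F_{\{1\}}\}| - |\{B\in S': F_B\in\overline F_{\{1\}}\}|, \] so only the part of $S$ belonging to $\overline F_{\{1\}}$ can vary in size. -/

import Mathlib

namespace LatticeIdeal

variable {n : ℕ}

/-- The integer vector `u - v ∈ ℤⁿ` of two exponent vectors `u, v ∈ ℕⁿ`. -/
def expDiff (u v : Fin n →₀ ℕ) : Fin n → ℤ := fun i => (u i : ℤ) - (v i : ℤ)

/-- The monomial `x^u` of `K[x_1, …, x_n]`. -/
noncomputable def mon (K : Type*) [Field K] (u : Fin n →₀ ℕ) : MvPolynomial (Fin n) K :=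
  MvPolynomial.monomial u 1

/-- The lattice ideal `I_L = ⟨x^u - x^v : u - v ∈ L⟩` of a lattice (subgroup) `L ⊆ ℤⁿ`. -/
noncomputable def latticeIdeal (K : Type*) [Field K] (L : AddSubgroup (Fin n → ℤ)) :
    Ideal (MvPolynomial (Fin n) K) :=
  Ideal.span {f | ∃ u v : Fin n →₀ ℕ, expDiff u v ∈ L ∧ f = mon K u - mon K v}

/-- The fiber `F_u = {x^v : v - u ∈ L}`. A monomial is identified with its exponent vector,
so a fiber is a set of exponent vectors. -/
def fiber (L : AddSubgroup (Fin n → ℤ)) (u : Fin n →₀ ℕ) : Set (Fin n →₀ ℕ) :=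
  {v | expDiff v u ∈ L}

/-- `F` is an `I_L`-fiber. -/
def IsFiber (L : AddSubgroup (Fin n → ℤ)) (F : Set (Fin n →₀ ℕ)) : Prop :=
  ∃ u, F = fiber L u

/-- `F ≡ G`: there are monomials `x^u`, `x^v` with `x^u F ⊆ G` and `x^v G ⊆ F`. -/
def FiberEquiv (F G : Set (Fin n →₀ ℕ)) : Prop :=
  ∃ u v : Fin n →₀ ℕ, (fun a => u + a) '' F ⊆ G ∧ (fun a => v + a) '' G ⊆ F

/-- The equivalence class `F̄` of a fiber `F`: all `I_L`-fibers equivalent to `F`. -/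
def fiberClass (L : AddSubgroup (Fin n → ℤ)) (F : Set (Fin n →₀ ℕ)) :
    Set (Set (Fin n →₀ ℕ)) :=
  {G | IsFiber L G ∧ FiberEquiv G F}

/-- The class of the fiber containing the monomial `1 = x^0`. -/
def fiberClassOne (L : AddSubgroup (Fin n → ℤ)) : Set (Set (Fin n →₀ ℕ)) :=
  fiberClass L (fiber L 0)

/-- A binomial is a polynomial `x^u - x^v` with `u ≠ v`. -/
def IsBinomial {K : Type*} [Field K] (B : MvPolynomial (Fin n) K) : Prop :=
  ∃ u v : Fin n →₀ ℕ, u ≠ v ∧ B = mon K u - mon K v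

/-- The fiber `F_B` of a binomial `B ∈ I_L`: the union of the fibers of the terms of `B`. The two
terms of a binomial `x^u - x^v ∈ I_L` have the same fiber, so this is `F_u`
(`fiberOf_binomial`). -/
def fiberOf {K : Type*} [Field K] (L : AddSubgroup (Fin n → ℤ)) (B : MvPolynomial (Fin n) K) :
    Set (Fin n →₀ ℕ) :=
  {a | ∃ u ∈ B.support, a ∈ fiber L u}

theorem fiber_eq_of_mem {L : AddSubgroup (Fin n → ℤ)} {u v : Fin n →₀ ℕ}
    (h : expDiff u v ∈ L) : fiber L u = fiber L v := by
  ext a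
  have e : expDiff a v = expDiff a u + expDiff u v := by
    funext i; simp [expDiff]
  simp only [fiber, Set.mem_ofPred_eq, e]
  exact (L.add_mem_cancel_right h).symm

theorem fiberOf_binomial {K : Type*} [Field K] {L : AddSubgroup (Fin n → ℤ)}
    {u v : Fin n →₀ ℕ} (huv : u ≠ v) (h : expDiff u v ∈ L) :
    fiberOf L (mon K u - mon K v) = fiber L u := by
  classical
  have hu : u ∈ (mon K u - mon K v).support := by
    simp [mon, MvPolynomial.coeff_monomial, huv.symm]
  have key : ∀ w ∈ (mon K u - mon K v).support, w = u ∨ w = v := by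
    intro w hw
    by_contra hc
    push Not at hc
    simp [mon, MvPolynomial.coeff_monomial, hc.1.symm, hc.2.symm] at hw
  ext a
  constructor
  · rintro ⟨w, hw, ha⟩
    rcases key w hw with rfl | rfl
    · exact ha
    · rw [fiber_eq_of_mem h]; exact ha
  · intro ha
    exact ⟨u, hu, ha⟩

/-- `S` is a minimal generating set of `I_L` consisting of binomials: it generates `I_L` and no
proper subset of it does. -/
def IsMinimalGeneratingSet {K : Type*} [Field K] (L : AddSubgroup (Fin n → ℤ))
    (S : Finset (MvPolynomial (Fin n) K)) : Prop :=
  (∀ B ∈ S, IsBinomial B) ∧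
  Ideal.span (S : Set (MvPolynomial (Fin n) K)) = latticeIdeal K L ∧
  ∀ T : Finset (MvPolynomial (Fin n) K), T ⊂ S →
    Ideal.span (T : Set (MvPolynomial (Fin n) K)) ≠ latticeIdeal K L

open Classical in
/-- The pure part of `S`: those `B ∈ S` with `F_B` in the class of the fiber of `1`. -/
noncomputable def purePart {K : Type*} [Field K] (L : AddSubgroup (Fin n → ℤ))
    (S : Finset (MvPolynomial (Fin n) K)) : Finset (MvPolynomial (Fin n) K) :=
  S.filter fun B => fiberOf L B ∈ fiberClassOne L

open Classical in
/-- The multiset of the classes of `F_B`, over those `B ∈ S` with `F_B` not in the class of the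
fiber of `1`. -/
noncomputable def nonpureClasses {K : Type*} [Field K] (L : AddSubgroup (Fin n → ℤ))
    (S : Finset (MvPolynomial (Fin n) K)) : Multiset (Set (Set (Fin n →₀ ℕ))) :=
  (S.filter fun B => fiberOf L B ∉ fiberClassOne L).val.map fun B => fiberClass L (fiberOf L B)

end LatticeIdeal

/-!
Grade the polynomial ring by `ℤⁿ / L`. Fibers are then the degrees of monomials, and `x^u F ⊆ G`
says that `x^u` multiplies degree `F` into degree `G`. Fix a degree `c` not equivalent to `0`, and
let `J` be the ideal generated by the homogeneous elements of `I` of degree strictly below `c`. A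
generator of degree equivalent to `c` can be shifted by a monomial into degree `c`, and the shifted
generators form a basis of the image of `I_c` modulo `J`; so their number is the dimension of a
space that depends only on `I` and `c`.

The shifts are reversible modulo `J`: if `x^q` undoes the shift `x^p`, then `x^(p+q)` has degree
`0`, so `x^(p+q) - 1` is an element of `I` of degree strictly below `c`. Hence a linear dependence
among the shifted generators makes one of the generators redundant, and two monomials of the same
degree shift a generator to the same element modulo `J`. In the class of `0` this breaks down,
because `x^(p+q) - 1` no longer lies strictly below `c`.
-/

namespace LatticeIdeal

open MvPolynomial
open Finsupp (weight)
open scoped Pointwise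

section Weighted

variable {σ M : Type*} [AddCommMonoid M] {w : σ → M}

/-- The divisibility preorder on degrees, for the grading of the polynomial ring in which `x_s` has
degree `w s`: some monomial multiplies degree `a` into degree `b`. -/
def DegLE (w : σ → M) (a b : M) : Prop :=
  ∃ p : σ →₀ ℕ, weight w p + a = b

theorem DegLE.refl (a : M) : DegLE w a a :=
  ⟨0, by rw [map_zero, zero_add]⟩

theorem DegLE.trans {a b c : M} (hab : DegLE w a b) (hbc : DegLE w b c) : DegLE w a c := by
  obtain ⟨p, rfl⟩ := hab
  obtain ⟨q, rfl⟩ := hbc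
  exact ⟨q + p, by rw [map_add, add_assoc]⟩

instance : Std.Refl (DegLE w) := ⟨DegLE.refl⟩

instance : IsTrans M (DegLE w) := ⟨fun _ _ _ => DegLE.trans⟩

theorem zero_degLE_weight (u : σ →₀ ℕ) : DegLE w 0 (weight w u) :=
  ⟨u, add_zero _⟩

theorem exists_weight_eq_of_isWeightedHomogeneous {R : Type*} [CommSemiring R]
    {f : MvPolynomial σ R} {a : M} (hf : IsWeightedHomogeneous w f a) (h0 : f ≠ 0) :
    ∃ u : σ →₀ ℕ, weight w u = a :=
  let ⟨u, hu⟩ := ne_zero_iff.1 h0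
  ⟨u, hf hu⟩

section Generators

variable {R ι : Type*} [CommSemiring R] {b : ι → MvPolynomial σ R} {d : ι → M}
  {f : MvPolynomial σ R} {a : M}

theorem mem_span_monomial_mul_of_isWeightedHomogeneous
    (hb : ∀ i, IsWeightedHomogeneous w (b i) (d i)) (hf : IsWeightedHomogeneous w f a)
    (hfb : f ∈ Ideal.span (Set.range b)) :
    f ∈ Submodule.span R {g | ∃ i u, weight w u + d i = a ∧ g = monomial u 1 * b i} := by
  have hfR : f ∈ Submodule.span R (Set.range (basisMonomials σ R) • Set.range b) := by
    rwa [Submodule.span_smul_of_span_eq_top (basisMonomials σ R).span_eq]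
  rw [← hf.weightedHomogeneousComponent_same]
  refine Submodule.span_le.2 ?_ (Submodule.apply_mem_span_image_of_mem_span _ hfR)
  rintro _ ⟨_, ⟨_, ⟨u, rfl⟩, _, ⟨i, rfl⟩, rfl⟩, rfl⟩
  have hui : IsWeightedHomogeneous w (monomial u (1 : R) * b i) (weight w u + d i) :=
    (isWeightedHomogeneous_monomial w u 1 rfl).mul (hb i)
  simp only [coe_basisMonomials, SetLike.mem_coe]
  by_cases h : weight w u + d i = a
  · rw [← h, hui.weightedHomogeneousComponent_same]
    exact Submodule.subset_span ⟨i, u, rfl, rfl⟩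
  · rw [hui.weightedHomogeneousComponent_ne a (Ne.symm h)]
    exact Submodule.zero_mem _

theorem mem_span_image_degLE_of_isWeightedHomogeneous
    (hb : ∀ i, IsWeightedHomogeneous w (b i) (d i)) (hf : IsWeightedHomogeneous w f a)
    (hfb : f ∈ Ideal.span (Set.range b)) :
    f ∈ Ideal.span (b '' {i | DegLE w (d i) a}) := by
  refine (Submodule.span_le (p := (Ideal.span _).restrictScalars R)).2 ?_
    (mem_span_monomial_mul_of_isWeightedHomogeneous hb hf hfb)
  rintro _ ⟨i, u, hu, rfl⟩
  exact Ideal.mul_mem_left _ _ (Ideal.subset_span ⟨i, ⟨u, hu⟩, rfl⟩)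

end Generators

section LowerIdeal

variable {R : Type*} [CommRing R] {I : Ideal (MvPolynomial σ R)} {c : M}

/-- The ideal generated by the homogeneous elements of `I` of degree strictly below `c` in the
preorder `DegLE`. Generators of degree equivalent to `c` are counted modulo this ideal. -/
noncomputable def lowerIdeal (w : σ → M) (I : Ideal (MvPolynomial σ R)) (c : M) :
    Ideal (MvPolynomial σ R) :=
  Ideal.span {f | f ∈ I ∧ ∃ a, IsWeightedHomogeneous w f a ∧ DegLE w a c ∧ ¬ DegLE w c a}

theorem monomial_sub_one_mem_lowerIdeal
    (hI : ∀ u : σ →₀ ℕ, weight w u = 0 → monomial u 1 - 1 ∈ I) (h0c : DegLE w 0 c)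
    (hc0 : ¬ DegLE w c 0) {u : σ →₀ ℕ} (hu : weight w u = 0) :
    monomial u 1 - 1 ∈ lowerIdeal w I c :=
  Ideal.subset_span ⟨hI u hu, 0,
    (isWeightedHomogeneous_monomial w u 1 hu).sub (isWeightedHomogeneous_one R w), h0c, hc0⟩

theorem monomial_sub_monomial_mem_of_degLE_zero
    (hI : ∀ u : σ →₀ ℕ, weight w u = 0 → monomial u 1 - 1 ∈ I) {u v : σ →₀ ℕ}
    (huv : weight w u = weight w v) (hu : DegLE w (weight w u) 0) :
    monomial u 1 - monomial v 1 ∈ I := by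
  obtain ⟨q, hq⟩ := hu
  have hqu := hI (q + u) (by rw [map_add, hq])
  have hqv := hI (q + v) (by rw [map_add, ← huv, hq])
  have hsplit : monomial u (1 : R) - monomial v 1 =
      monomial v 1 * (monomial (q + u) 1 - 1) - monomial u 1 * (monomial (q + v) 1 - 1) := by
    simp only [mul_sub, monomial_mul, mul_one, add_left_comm v q u, add_left_comm u q v,
      add_comm v u]
    ring
  rw [hsplit]
  exact I.sub_mem (I.mul_mem_left _ hqu) (I.mul_mem_left _ hqv)

variable {ι : Type*} {b : ι → MvPolynomial σ R} {d : ι → M}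

theorem lowerIdeal_span_range_le (hb : ∀ i, IsWeightedHomogeneous w (b i) (d i)) {i : ι}
    (hi : DegLE w c (d i)) :
    lowerIdeal w (Ideal.span (Set.range b)) c ≤ Ideal.span (b '' {i}ᶜ) := by
  refine Ideal.span_le.2 ?_
  rintro f ⟨hfb, a, hfa, -, hca⟩
  have hsub : {j | DegLE w (d j) a} ⊆ {i}ᶜ := by
    rintro j hj rfl
    exact hca (hi.trans hj)
  exact Ideal.span_mono (Set.image_mono hsub)
    (mem_span_image_degLE_of_isWeightedHomogeneous hb hfa hfb)

theorem monomial_mul_notMem_span_image_compl [IsCancelAdd M]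
    (hb : ∀ i, IsWeightedHomogeneous w (b i) (d i))
    (hmin : ∀ i, b i ∉ Ideal.span (b '' {i}ᶜ))
    (hI : ∀ u : σ →₀ ℕ, weight w u = 0 → monomial u 1 - 1 ∈ Ideal.span (Set.range b))
    (h0c : DegLE w 0 c) (hc0 : ¬ DegLE w c 0) {i : ι} {u : σ →₀ ℕ}
    (hu : weight w u + d i = c) (hi : DegLE w c (d i)) :
    monomial u 1 * b i ∉ Ideal.span (b '' {i}ᶜ) := by
  intro hmem
  refine hmin i ?_
  have ⟨q, hq⟩ := hi
  have hqu : weight w (q + u) = 0 := by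
    rwa [← hu, ← add_assoc, add_eq_right, ← map_add] at hq
  have hunit := lowerIdeal_span_range_le hb hi (monomial_sub_one_mem_lowerIdeal hI h0c hc0 hqu)
  have hsplit : b i =
      monomial q 1 * (monomial u 1 * b i) - (monomial (q + u) 1 - 1) * b i := by
    rw [← mul_assoc, monomial_mul, mul_one]
    ring
  rw [hsplit]
  exact sub_mem (Ideal.mul_mem_left _ _ hmem) (Ideal.mul_mem_right _ _ hunit)

end LowerIdeal

section Dimension

variable {R ι : Type*} [CommRing R] {b : ι → MvPolynomial σ R} {d : ι → M} {c : M}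

/-- The image modulo `lowerIdeal w I c` of the degree `c` part of `I`. Over a field, its dimension
counts the generators of degree equivalent to `c` in any minimal homogeneous generating set of `I`,
when `c` is a degree of monomials not equivalent to `0` and `x^u - 1 ∈ I` for all `x^u` of degree
`0`. -/
noncomputable def newPart (w : σ → M) (I : Ideal (MvPolynomial σ R)) (c : M) :
    Submodule R (MvPolynomial σ R ⧸ lowerIdeal w I c) :=
  (I.restrictScalars R ⊓ weightedHomogeneousSubmodule R w c).map
    (Ideal.Quotient.mkₐ R (lowerIdeal w I c)).toLinearMap

/-- The class modulo `lowerIdeal` of the multiple `x^(p i) b_i` of a generator `b_i` whose degree is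
equivalent to `c`; the shift `p i` will be chosen to bring it into degree `c`. -/
noncomputable def shiftedGenerator (w : σ → M) (b : ι → MvPolynomial σ R) (d : ι → M) (c : M)
    (p : {i // AntisymmRel (DegLE w) (d i) c} → σ →₀ ℕ)
    (i : {i // AntisymmRel (DegLE w) (d i) c}) :
    MvPolynomial σ R ⧸ lowerIdeal w (Ideal.span (Set.range b)) c :=
  Ideal.Quotient.mk _ (monomial (p i) 1 * b i)

variable [IsCancelAdd M] {p : {i // AntisymmRel (DegLE w) (d i) c} → σ →₀ ℕ}

theorem mk_monomial_mul_mem_span_shiftedGenerator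
    (hb : ∀ i, IsWeightedHomogeneous w (b i) (d i))
    (hI : ∀ u : σ →₀ ℕ, weight w u = 0 → monomial u 1 - 1 ∈ Ideal.span (Set.range b))
    (h0c : DegLE w 0 c) (hc0 : ¬ DegLE w c 0) (hp : ∀ i, weight w (p i) + d i = c)
    {i : ι} {u : σ →₀ ℕ} (hu : weight w u + d i = c) :
    Ideal.Quotient.mk (lowerIdeal w (Ideal.span (Set.range b)) c) (monomial u 1 * b i) ∈
      Submodule.span R (Set.range (shiftedGenerator w b d c p)) := by
  by_cases hci : DegLE w c (d i)
  · let i' : {i // AntisymmRel (DegLE w) (d i) c} := ⟨i, ⟨u, hu⟩, hci⟩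
    have hup : weight w u = weight w (p i') := add_right_cancel (hu.trans (hp i').symm)
    have hu0 : DegLE w (weight w u) 0 := by
      obtain ⟨q, hq⟩ := hci
      exact ⟨q, by rwa [← hu, ← add_assoc, add_eq_right] at hq⟩
    have heq : Ideal.Quotient.mk (lowerIdeal w (Ideal.span (Set.range b)) c)
        (monomial u 1 * b i) = shiftedGenerator w b d c p i' := by
      refine Ideal.Quotient.eq.2 ?_
      rw [← sub_mul]
      exact Ideal.mul_mem_right _ _ (monomial_sub_monomial_mem_of_degLE_zero
        (fun _ => monomial_sub_one_mem_lowerIdeal hI h0c hc0) hup hu0)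
    rw [heq]
    exact Submodule.subset_span ⟨i', rfl⟩
  · have hbi : b i ∈ lowerIdeal w (Ideal.span (Set.range b)) c :=
      Ideal.subset_span ⟨Ideal.subset_span ⟨i, rfl⟩, d i, hb i, ⟨u, hu⟩, hci⟩
    rw [Ideal.Quotient.eq_zero_iff_mem.2 (Ideal.mul_mem_left _ _ hbi)]
    exact Submodule.zero_mem _

theorem span_shiftedGenerator (hb : ∀ i, IsWeightedHomogeneous w (b i) (d i))
    (hI : ∀ u : σ →₀ ℕ, weight w u = 0 → monomial u 1 - 1 ∈ Ideal.span (Set.range b))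
    (h0c : DegLE w 0 c) (hc0 : ¬ DegLE w c 0) (hp : ∀ i, weight w (p i) + d i = c) :
    Submodule.span R (Set.range (shiftedGenerator w b d c p)) =
      newPart w (Ideal.span (Set.range b)) c := by
  refine le_antisymm (Submodule.span_le.2 ?_) (Submodule.map_le_iff_le_comap.2 ?_)
  · rintro _ ⟨i, rfl⟩
    have hdeg := (isWeightedHomogeneous_monomial w (p i) (1 : R) rfl).mul (hb i)
    rw [hp] at hdeg
    exact Submodule.mem_map_of_mem
      ⟨Ideal.mul_mem_left _ _ (Ideal.subset_span (Set.mem_range_self _)), hdeg⟩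
  · rintro f ⟨hfb, hfc⟩
    refine Submodule.span_le.2 ?_ (mem_span_monomial_mul_of_isWeightedHomogeneous hb hfc hfb)
    rintro _ ⟨i, u, hu, rfl⟩
    exact mk_monomial_mul_mem_span_shiftedGenerator hb hI h0c hc0 hp hu

variable {K : Type*} [Field K] {b : ι → MvPolynomial σ K}

theorem linearIndependent_shiftedGenerator (hb : ∀ i, IsWeightedHomogeneous w (b i) (d i))
    (hmin : ∀ i, b i ∉ Ideal.span (b '' {i}ᶜ))
    (hI : ∀ u : σ →₀ ℕ, weight w u = 0 → monomial u 1 - 1 ∈ Ideal.span (Set.range b))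
    (h0c : DegLE w 0 c) (hc0 : ¬ DegLE w c 0) (hp : ∀ i, weight w (p i) + d i = c) :
    LinearIndependent K (shiftedGenerator w b d c p) := by
  rw [linearIndependent_iff_notMem_span]
  intro i hi
  refine monomial_mul_notMem_span_image_compl hb hmin hI h0c hc0 (hp i) i.2.2 ?_
  rw [← Ideal.mem_quotient_iff_mem (lowerIdeal_span_range_le hb i.2.2)]
  refine (Submodule.span_le (p := (Ideal.map _ _).restrictScalars K)).2 ?_ hi
  rintro _ ⟨j, ⟨-, hji⟩, rfl⟩
  have hji' : (j : ι) ∈ ({(i : ι)}ᶜ : Set ι) := fun h => hji (Subtype.ext h)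
  exact Ideal.mem_map_of_mem _
    (Ideal.mul_mem_left _ _ (Ideal.subset_span (Set.mem_image_of_mem b hji')))

theorem natCard_antisymmRel_degLE_eq_finrank_newPart
    (hb : ∀ i, IsWeightedHomogeneous w (b i) (d i)) (hmin : ∀ i, b i ∉ Ideal.span (b '' {i}ᶜ))
    (hI : ∀ u : σ →₀ ℕ, weight w u = 0 → monomial u 1 - 1 ∈ Ideal.span (Set.range b))
    (h0c : DegLE w 0 c) (hc0 : ¬ DegLE w c 0) :
    Nat.card {i // AntisymmRel (DegLE w) (d i) c} =
      Module.finrank K (newPart w (Ideal.span (Set.range b)) c) := by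
  choose p hp using fun i : {i // AntisymmRel (DegLE w) (d i) c} => i.2.1
  rw [← span_shiftedGenerator hb hI h0c hc0 hp]
  exact (Module.finrank_eq_nat_card_basis
    (Module.Basis.span (linearIndependent_shiftedGenerator hb hmin hI h0c hc0 hp))).symm

end Dimension

end Weighted

section Lattice

variable {n : ℕ} {L : AddSubgroup (Fin n → ℤ)}

/-- The weights of the grading of `K[x_1, …, x_n]` by `ℤⁿ / L`: the degree of `x_i` is the class of
the `i`-th unit vector. -/
def latticeWeight (L : AddSubgroup (Fin n → ℤ)) (i : Fin n) : (Fin n → ℤ) ⧸ L :=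
  QuotientAddGroup.mk (Pi.single i 1)

theorem weight_latticeWeight (u : Fin n →₀ ℕ) :
    weight (latticeWeight L) u = QuotientAddGroup.mk fun i => (u i : ℤ) := by
  have hu : (fun i => (u i : ℤ)) = ∑ i, u i • Pi.single i 1 := by
    ext j
    simp [Finset.sum_apply, Pi.single_apply]
  rw [Finsupp.weight_apply, Finsupp.sum_fintype _ _ (by simp), hu]
  exact (map_sum (QuotientAddGroup.mk' L) _ _).symm

theorem weight_eq_weight_iff {u v : Fin n →₀ ℕ} :
    weight (latticeWeight L) u = weight (latticeWeight L) v ↔ expDiff u v ∈ L := by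
  rw [weight_latticeWeight, weight_latticeWeight, eq_comm, QuotientAddGroup.eq, neg_add_eq_sub]
  rfl

theorem mem_fiber_iff {u v : Fin n →₀ ℕ} :
    v ∈ fiber L u ↔ weight (latticeWeight L) v = weight (latticeWeight L) u :=
  weight_eq_weight_iff.symm

theorem image_fiber_subset_fiber_iff {p u v : Fin n →₀ ℕ} :
    (fun a => p + a) '' fiber L u ⊆ fiber L v ↔
      weight (latticeWeight L) p + weight (latticeWeight L) u = weight (latticeWeight L) v := by
  rw [Set.image_subset_iff]
  refine ⟨fun h => ?_, fun h a ha => ?_⟩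
  · rw [← map_add]
    exact mem_fiber_iff.1 (h (mem_fiber_iff.2 rfl))
  · rw [Set.mem_preimage, mem_fiber_iff, map_add, mem_fiber_iff.1 ha, h]

theorem fiberEquiv_fiber_iff {u v : Fin n →₀ ℕ} :
    FiberEquiv (fiber L u) (fiber L v) ↔
      AntisymmRel (DegLE (latticeWeight L)) (weight (latticeWeight L) u)
        (weight (latticeWeight L) v) := by
  simp only [FiberEquiv, image_fiber_subset_fiber_iff, AntisymmRel, DegLE, exists_and_left,
    exists_and_right]

theorem fiber_mem_fiberClass_fiber_iff {u v : Fin n →₀ ℕ} :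
    fiber L u ∈ fiberClass L (fiber L v) ↔
      AntisymmRel (DegLE (latticeWeight L)) (weight (latticeWeight L) u)
        (weight (latticeWeight L) v) :=
  (and_iff_right ⟨u, rfl⟩).trans fiberEquiv_fiber_iff

theorem fiberClass_fiber_eq_iff {u v : Fin n →₀ ℕ} :
    fiberClass L (fiber L u) = fiberClass L (fiber L v) ↔
      AntisymmRel (DegLE (latticeWeight L)) (weight (latticeWeight L) u)
        (weight (latticeWeight L) v) := by
  refine ⟨fun h => ?_, fun h => ?_⟩
  · rw [← fiber_mem_fiberClass_fiber_iff, ← h, fiber_mem_fiberClass_fiber_iff]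
  · ext G
    refine and_congr_right ?_
    rintro ⟨x, rfl⟩
    rw [fiberEquiv_fiber_iff, fiberEquiv_fiber_iff]
    exact ⟨fun hxu => hxu.trans h, fun hxv => hxv.trans h.symm⟩

theorem fiber_mem_fiberClassOne_iff {u : Fin n →₀ ℕ} :
    fiber L u ∈ fiberClassOne L ↔ DegLE (latticeWeight L) (weight (latticeWeight L) u) 0 := by
  rw [fiberClassOne, fiber_mem_fiberClass_fiber_iff, map_zero]
  exact and_iff_left (zero_degLE_weight u)

variable {K : Type*} [Field K]

theorem fiberOf_eq_fiber {B : MvPolynomial (Fin n) K} {u : Fin n →₀ ℕ}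
    (hB : IsWeightedHomogeneous (latticeWeight L) B (weight (latticeWeight L) u))
    (h0 : B ≠ 0) : fiberOf L B = fiber L u := by
  obtain ⟨v, hv⟩ := ne_zero_iff.1 h0
  ext a
  simp only [fiberOf, Set.mem_ofPred_eq, mem_fiber_iff]
  constructor
  · rintro ⟨x, hx, hax⟩
    exact hax.trans (hB (mem_support_iff.1 hx))
  · exact fun ha => ⟨v, mem_support_iff.2 hv, ha.trans (hB hv).symm⟩

theorem weight_eq_of_mon_sub_mon_mem_latticeIdeal {u v : Fin n →₀ ℕ}
    (h : mon K u - mon K v ∈ latticeIdeal K L) :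
    weight (latticeWeight L) u = weight (latticeWeight L) v := by
  let φ := AddMonoidAlgebra.mapDomainRingHom K (weight (R := ℕ) (latticeWeight L))
  have hφ (u : Fin n →₀ ℕ) :
      φ (mon K u) = AddMonoidAlgebra.single (weight (latticeWeight L) u) 1 :=
    AddMonoidAlgebra.mapDomain_single
  have hker : latticeIdeal K L ≤ RingHom.ker φ := by
    refine Ideal.span_le.2 ?_
    rintro _ ⟨p, q, hpq, rfl⟩
    rw [SetLike.mem_coe, RingHom.mem_ker, map_sub, hφ, hφ, weight_eq_weight_iff.2 hpq, sub_self]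
  have hsingle := hker h
  rw [RingHom.mem_ker, map_sub, hφ, hφ, sub_eq_zero] at hsingle
  exact AddMonoidAlgebra.single_left_injective one_ne_zero hsingle

theorem mon_sub_one_mem_latticeIdeal {u : Fin n →₀ ℕ} (hu : u ∈ fiber L 0) :
    mon K u - 1 ∈ latticeIdeal K L :=
  Ideal.subset_span ⟨u, 0, hu, rfl⟩

/-- `S` is a minimal generating set of the ideal `I` by polynomials homogeneous for the grading by
`ℤⁿ / L`. -/
structure IsMinimalHomogeneousGeneratingSet (L : AddSubgroup (Fin n → ℤ))
    (I : Ideal (MvPolynomial (Fin n) K)) (S : Finset (MvPolynomial (Fin n) K)) : Prop where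
  isWeightedHomogeneous : ∀ B ∈ S, ∃ a, IsWeightedHomogeneous (latticeWeight L) B a
  span_eq : Ideal.span (S : Set (MvPolynomial (Fin n) K)) = I
  notMem_span_diff : ∀ B ∈ S, B ∉ Ideal.span ((S : Set (MvPolynomial (Fin n) K)) \ {B})

variable {S S' : Finset (MvPolynomial (Fin n) K)} {I : Ideal (MvPolynomial (Fin n) K)}

theorem IsMinimalGeneratingSet.isMinimalHomogeneousGeneratingSet
    (hS : IsMinimalGeneratingSet L S) :
    IsMinimalHomogeneousGeneratingSet L (latticeIdeal K L) S where
  isWeightedHomogeneous B hB := by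
    obtain ⟨u, v, -, rfl⟩ := hS.1 B hB
    have huv := weight_eq_of_mon_sub_mon_mem_latticeIdeal (hS.2.1 ▸ Ideal.subset_span hB)
    exact ⟨_, (isWeightedHomogeneous_monomial _ u 1 rfl).sub
      (isWeightedHomogeneous_monomial _ v 1 huv.symm)⟩
  span_eq := hS.2.1
  notMem_span_diff B hB hmem := by
    classical
    refine hS.2.2 (S.erase B) (Finset.erase_ssubset hB) ?_
    rw [← hS.2.1, Finset.coe_erase, Ideal.span, ← Submodule.span_insert_eq_span hmem,
      Set.insert_sdiff_singleton, Set.insert_eq_of_mem (Finset.mem_coe.2 hB)]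

namespace IsMinimalHomogeneousGeneratingSet

theorem exists_fiberOf_eq_fiber (hS : IsMinimalHomogeneousGeneratingSet L I S)
    {B : MvPolynomial (Fin n) K} (hB : B ∈ S) :
    ∃ u, IsWeightedHomogeneous (latticeWeight L) B (weight (latticeWeight L) u) ∧
      fiberOf L B = fiber L u := by
  have h0 : B ≠ 0 := by
    rintro rfl
    exact hS.notMem_span_diff 0 hB (Ideal.zero_mem _)
  obtain ⟨a, ha⟩ := hS.isWeightedHomogeneous B hB
  obtain ⟨u, rfl⟩ := exists_weight_eq_of_isWeightedHomogeneous ha h0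
  exact ⟨u, ha, fiberOf_eq_fiber ha h0⟩

open Classical in
theorem card_filter_fiberClass_eq_finrank_newPart (hS : IsMinimalHomogeneousGeneratingSet L I S)
    (hI : ∀ u ∈ fiber L 0, mon K u - 1 ∈ I) {c : Fin n →₀ ℕ} (hc : fiber L c ∉ fiberClassOne L) :
    (S.filter fun B => fiberClass L (fiberOf L B) = fiberClass L (fiber L c)).card =
      Module.finrank K (newPart (latticeWeight L) I (weight (latticeWeight L) c)) := by
  choose e he using fun B : S => hS.exists_fiberOf_eq_fiber B.2
  have hrange : Ideal.span (Set.range ((↑) : S → MvPolynomial (Fin n) K)) = I := by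
    rw [Subtype.range_coe, ← hS.span_eq]
  have hmin (B : S) : B.1 ∉ Ideal.span (((↑) : S → MvPolynomial (Fin n) K) '' {B}ᶜ) := by
    rw [Set.image_compl_eq_range_sdiff_image Subtype.val_injective, Set.image_singleton,
      Subtype.range_coe]
    exact hS.notMem_span_diff B B.2
  have hI' (u : Fin n →₀ ℕ) (hu : weight (latticeWeight L) u = 0) :
      monomial u 1 - 1 ∈ Ideal.span (Set.range ((↑) : S → MvPolynomial (Fin n) K)) := by
    rw [hrange]
    exact hI u (mem_fiber_iff.2 (hu.trans (map_zero _).symm))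
  rw [fiber_mem_fiberClassOne_iff] at hc
  rw [← hrange, ← natCard_antisymmRel_degLE_eq_finrank_newPart (fun B => (he B).1) hmin hI'
    (zero_degLE_weight c) hc]
  simp only [← fiberClass_fiber_eq_iff, ← (he _).2]
  exact ((Nat.card_congr (Equiv.subtypeSubtypeEquivSubtypeInter (· ∈ S) _)).trans
    (Nat.subtype_card _ fun _ => Finset.mem_filter)).symm

open Classical in
theorem count_nonpureClasses_eq_finrank_newPart (hS : IsMinimalHomogeneousGeneratingSet L I S)
    (hI : ∀ u ∈ fiber L 0, mon K u - 1 ∈ I) {c : Fin n →₀ ℕ} (hc : fiber L c ∉ fiberClassOne L) :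
    (nonpureClasses L S).count (fiberClass L (fiber L c)) =
      Module.finrank K (newPart (latticeWeight L) I (weight (latticeWeight L) c)) := by
  rw [← hS.card_filter_fiberClass_eq_finrank_newPart hI hc, nonpureClasses, Multiset.count_map,
    ← Finset.filter_val, Finset.filter_filter, Finset.card_val]
  congr 1
  refine Finset.filter_congr fun B hB => ?_
  obtain ⟨u, -, hu⟩ := hS.exists_fiberOf_eq_fiber hB
  rw [eq_comm, hu, and_iff_right_iff_imp, fiberClass_fiber_eq_iff]
  rw [fiber_mem_fiberClassOne_iff] at hc ⊢
  exact fun hBc hB0 => hc (hBc.2.trans hB0)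

theorem exists_fiber_of_mem_nonpureClasses (hS : IsMinimalHomogeneousGeneratingSet L I S)
    {X : Set (Set (Fin n →₀ ℕ))} (hX : X ∈ nonpureClasses L S) :
    ∃ c, fiber L c ∉ fiberClassOne L ∧ X = fiberClass L (fiber L c) := by
  classical
  obtain ⟨B, hB, rfl⟩ := Multiset.mem_map.1 hX
  obtain ⟨hBS, hB1⟩ := Finset.mem_filter.1 (Finset.mem_def.2 hB)
  obtain ⟨u, -, hu⟩ := hS.exists_fiberOf_eq_fiber hBS
  rw [hu] at hB1 ⊢
  exact ⟨u, hB1, rfl⟩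

theorem nonpureClasses_eq (hS : IsMinimalHomogeneousGeneratingSet L I S)
    (hS' : IsMinimalHomogeneousGeneratingSet L I S') (hI : ∀ u ∈ fiber L 0, mon K u - 1 ∈ I) :
    nonpureClasses L S = nonpureClasses L S' := by
  classical
  refine Multiset.ext' fun X => ?_
  by_cases hX : ∃ c, fiber L c ∉ fiberClassOne L ∧ X = fiberClass L (fiber L c)
  · obtain ⟨c, hc, rfl⟩ := hX
    rw [hS.count_nonpureClasses_eq_finrank_newPart hI hc,
      hS'.count_nonpureClasses_eq_finrank_newPart hI hc]
  · rw [Multiset.count_eq_zero_of_notMem (hX ∘ hS.exists_fiber_of_mem_nonpureClasses),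
      Multiset.count_eq_zero_of_notMem (hX ∘ hS'.exists_fiber_of_mem_nonpureClasses)]

end IsMinimalHomogeneousGeneratingSet

theorem card_purePart_add_card_nonpureClasses (L : AddSubgroup (Fin n → ℤ))
    (S : Finset (MvPolynomial (Fin n) K)) :
    (purePart L S).card + (nonpureClasses L S).card = S.card := by
  classical
  rw [nonpureClasses, Multiset.card_map, Finset.card_val, purePart]
  exact Finset.card_filter_add_card_filter_not _

end Lattice

end LatticeIdeal

open LatticeIdeal in
theorem corollary4p12_general {K : Type*} [Field K] {n : ℕ} {L : AddSubgroup (Fin n → ℤ)}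
    {I : Ideal (MvPolynomial (Fin n) K)} (hI : ∀ u ∈ fiber L 0, mon K u - 1 ∈ I)
    {S S' : Finset (MvPolynomial (Fin n) K)} (hS : IsMinimalHomogeneousGeneratingSet L I S)
    (hS' : IsMinimalHomogeneousGeneratingSet L I S') :
    nonpureClasses L S = nonpureClasses L S' ∧
      (S.card : ℤ) - (S'.card : ℤ) =
        ((purePart L S).card : ℤ) - ((purePart L S').card : ℤ) := by
  have hclasses := hS.nonpureClasses_eq hS' hI
  have hcard := card_purePart_add_card_nonpureClasses L S
  have hcard' := card_purePart_add_card_nonpureClasses L S'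
  rw [hclasses] at hcard
  exact ⟨hclasses, by lia⟩

theorem corollary4p12 {K : Type*} [Field K] {n : ℕ} (L : AddSubgroup (Fin n → ℤ))
    (S S' : Finset (MvPolynomial (Fin n) K))
    (hS : LatticeIdeal.IsMinimalGeneratingSet L S)
    (hS' : LatticeIdeal.IsMinimalGeneratingSet L S') :
    LatticeIdeal.nonpureClasses L S = LatticeIdeal.nonpureClasses L S' ∧
    (S.card : ℤ) - (S'.card : ℤ) =
      ((LatticeIdeal.purePart L S).card : ℤ) - ((LatticeIdeal.purePart L S').card : ℤ) :=
  corollary4p12_general (fun _ => LatticeIdeal.mon_sub_one_mem_latticeIdeal)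
    hS.isMinimalHomogeneousGeneratingSet hS'.isMinimalHomogeneousGeneratingSet
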